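/- Consider a composite system of $N$ subsystems $$\dot x_i=f_i(x)+g_i(x)u_i,\qquad y_i=h_i(x_i),\qquad i=1,\dots,N,$$ with $x=(x_1,\dots,x_N)\in\mathbb R^{n}$, $x_i\in\mathbb R^{n_i}$, $n=\sum_i n_i$, $u_i\in\mathbb R^{m_i}$, $y_i\in\mathbb R^{l_i}$, where $f_i,g_i,h_i$ are smooth functions, $f_i(0)=0$ and $h_i(0)=0$. Fix $\rho>0$ and let $S_\rho=\{x\in\mathbb R^n:\|x\|\le\rho\}$ (Euclidean norm). Put $K_i=\{h_i(x_i):x\in S_\rho\}$ and $\widetilde K_i(y_i)=\{x\in S_\rho:h_i(x_i)=y_i\}$. Suppose there is an output control vector Lyapunov function (OCVLF) triple $\{V,\Lambda,S_\rho\}$, that is: $V(x)=(V_1(x_1),\dots,V_N(x_N))$ is continuously differentiable on $S_\rho$ with values in $\mathbb R^N_+$ (the nonnegative orthant); $\Lambda:\mathbb R^N_+\to\mathbb R^N$ is locally Lipschitz with $\Lambda(0)=0$ and quasimonotone nondecreasing (if $z\preceq z'$ componentwise and $z_i=z_i'$, then $\Lambda_i(z)\le\Lambda_i(z')$); and for each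 $i$: (i) $V_i$ is positive definite: $V_i(0)=0$ and $V_i(x_i)>0$ for $0<\|x_i\|\le\rho$; (ii) for each $y_i\in K_i\setminus\{0\}$ there is $u_i\in\mathbb R^{m_i}$ such that $$\nabla V_i(x_i)\cdot f_i(x)+\nabla V_i(x_i)\cdot g_i(x)u_i<\Lambda_i(V(x))\quad\text{for all }x\in\widetilde K_i(y_i);\tag{$*$}$$ (iii) $\nabla V_i(x_i)\cdot f_i(x)<\Lambda_i(V(x))$ for all $x\in\widetilde K_i(0)\setminus\{0\}$; (iv) the trivial solution of $\dot z=\Lambda(z)$, $z(0)\in\mathbb R^N_+$, is (locally) asymptotically stable. Suppose in addition that the decentralized small control property holds for this $V$ and $\Lambda$: for each $i$ there is a continuous positive definite function $\mu_i:\mathbb R^{l_i}\to\mathbb R_+$ such that for each $y_i\in K_i\setminus\{0\}$ there is $u_i\in\mathbb R^{m_i}$ with $\|u_i\|<\mu_i(y_i)$ satisfying $(*)$. Then there are continuous functions $\Gamma_i:\mathbb R^{l_i}\to\mathbb R^{m_i}$ with $\Gamma_i(0)=0$, $i=1,\dots,N$, such that the decentralized output feedback law $u_i=\Gamma_i(y_i)=\Gamma_i(h_i(x_i))$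 makes the origin (locally) asymptotically stable for the closed-loop system $\dot x_i=f_i(x)+g_i(x)\Gamma_i(h_i(x_i))$. Here, since solutions of the closed loop need not be unique, asymptotic stability means that solutions starting sufficiently close to $0$ exist and can be continued to $[0,\infty)$, that every solution starting sufficiently close to $0$ stays in any prescribed neighbourhood of $0$, and that every solution on $[0,\infty)$ starting sufficiently close to $0$ tends to $0$. -/

import Mathlib

open Set Filter Topology
open scoped ContDiff

/-- Euclidean space `ℝ^k`. -/
abbrev Euc (k : ℕ) : Type := EuclideanSpace ℝ (Fin k)

/-- The state space of a system with `N` subsystems of dimensions `n i`: the Euclidean space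
`ℝ^{n 1} × ⋯ × ℝ^{n N}` with its Euclidean norm; `x i` is the state of the `i`-th subsystem. -/
abbrev StateSpace {N : ℕ} (n : Fin N → ℕ) : Type := PiLp 2 fun i => Euc (n i)

/-- A composite control-affine system `ẋ_i = f_i(x) + g_i(x) u_i`, `y_i = h_i(x_i)` with smooth
data, `f(0) = 0` and `h(0) = 0`.  The matrix `g_i(x)` is given as the linear map
`ℝ^{m i} → ℝ^{n i}`. -/
structure CompositeSystem {N : ℕ} (n m l : Fin N → ℕ) where
  f : ∀ i, StateSpace n → Euc (n i)
  g : ∀ i, StateSpace n → (Euc (m i) →L[ℝ] Euc (n i))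
  h : ∀ i, Euc (n i) → Euc (l i)
  f_smooth : ∀ i, ContDiff ℝ ∞ (f i)
  g_smooth : ∀ i, ContDiff ℝ ∞ (g i)
  h_smooth : ∀ i, ContDiff ℝ ∞ (h i)
  f_zero : ∀ i, f i 0 = 0
  h_zero : ∀ i, h i 0 = 0

/-- `x` solves `ẋ = F(x)` on the time interval `I` and stays in the set `D` there (one-sided
derivatives at the end points of `I`). -/
def IsSolutionOn {E : Type*} [NormedAddCommGroup E] [NormedSpace ℝ E]
    (F : E → E) (D : Set E) (x : ℝ → E) (I : Set ℝ) : Prop :=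
  ∀ t ∈ I, x t ∈ D ∧ HasDerivWithinAt x (F (x t)) I t

/-- (Local) asymptotic stability of the trivial solution of `ẋ = F(x)` on the state set `D`.
Solutions need not be unique, so the requirements are imposed on every solution. -/
structure IsAsymptoticallyStable {E : Type*} [NormedAddCommGroup E] [NormedSpace ℝ E]
    (F : E → E) (D : Set E) : Prop where
  /-- `0` is an equilibrium. -/
  equilibrium : (0 : E) ∈ D ∧ F 0 = 0
  /-- Solutions starting near `0` stay near `0`. -/
  stable : ∀ ε > 0, ∃ δ > 0, ∀ T : ℝ, 0 ≤ T → ∀ x : ℝ → E, IsSolutionOn F D x (Icc 0 T) →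
    ‖x 0‖ < δ → ∀ t ∈ Icc 0 T, ‖x t‖ < ε
  /-- Solutions starting near `0` can be continued for all future times; with `T = 0` this says
  that a solution on `[0, ∞)` exists for every initial value near `0`. -/
  continuable : ∃ δ > 0, ∀ T : ℝ, 0 ≤ T → ∀ x : ℝ → E, IsSolutionOn F D x (Icc 0 T) →
    ‖x 0‖ < δ → ∃ x' : ℝ → E, EqOn x' x (Icc 0 T) ∧ IsSolutionOn F D x' (Ici 0)
  /-- Solutions starting near `0` converge to `0`. -/
  attractive : ∃ δ > 0, ∀ x : ℝ → E, IsSolutionOn F D x (Ici 0) →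
    ‖x 0‖ < δ → Tendsto x atTop (𝓝 0)

/-- The nonnegative orthant `ℝ^N_+`. -/
def orthant (N : ℕ) : Set (Euc N) := {z | ∀ i, 0 ≤ z i}

/-- `w` is quasimonotone nondecreasing on the set `D`. -/
def QuasimonotoneOn {N : ℕ} (w : Euc N → Euc N) (D : Set (Euc N)) : Prop :=
  ∀ i, ∀ z ∈ D, ∀ z' ∈ D, z i = z' i → (∀ j, z j ≤ z' j) → w z i ≤ w z' i

/-- The vector function `V(x) = (V_1(x_1), …, V_N(x_N))`. -/
def vectorV {N : ℕ} {n : Fin N → ℕ} (V : ∀ i, Euc (n i) → ℝ) (x : StateSpace n) : Euc N :=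
  WithLp.toLp 2 fun i => V i (x i)

/-- The derivative `∇V_i(x_i) · v` of `V_i`, a function on the closed ball of radius `ρ` of
`ℝ^{n i}` (the set of the `x_i` with `x ∈ S_ρ`), in the direction `v`. -/
noncomputable def dirDeriv {N : ℕ} {n : Fin N → ℕ} (V : ∀ i, Euc (n i) → ℝ) (ρ : ℝ) (i : Fin N)
    (x : StateSpace n) (v : Euc (n i)) : ℝ :=
  fderivWithin ℝ (V i) (Metric.closedBall 0 ρ) (x i) v

namespace CompositeSystem

variable {N : ℕ} {n m l : Fin N → ℕ}

/-- The set `K_i(Q)` of the outputs `h_i(x_i)` with `x ∈ Q`. -/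
def K (S : CompositeSystem n m l) (i : Fin N) (Q : Set (StateSpace n)) : Set (Euc (l i)) :=
  {y | ∃ x ∈ Q, S.h i (x i) = y}

/-- The set of the `x` in the closed ball `S_ρ` with `h_i(x_i) = y`. -/
def Ktilde (S : CompositeSystem n m l) (ρ : ℝ) (i : Fin N) (y : Euc (l i)) :
    Set (StateSpace n) :=
  {x | x ∈ Metric.closedBall 0 ρ ∧ S.h i (x i) = y}

/-- The inequality `L_{f_i}V_i(x) + L_{g_i}V_i(x) · u < Λ_i(V(x))` for all `x` in the ball `S_ρ`
with `h_i(x_i) = y`. -/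
def Admissible (S : CompositeSystem n m l) (V : ∀ i, Euc (n i) → ℝ) (Λ : Euc N → Euc N) (ρ : ℝ)
    (i : Fin N) (y : Euc (l i)) (u : Euc (m i)) : Prop :=
  ∀ x ∈ S.Ktilde ρ i y,
    dirDeriv V ρ i x (S.f i x) + dirDeriv V ρ i x (S.g i x u) < Λ (vectorV V x) i

/-- `(V, Λ, S_ρ)` is an output control vector Lyapunov function triple for the system. -/
structure IsOCVLF (S : CompositeSystem n m l) (V : ∀ i, Euc (n i) → ℝ) (Λ : Euc N → Euc N)
    (ρ : ℝ) : Prop where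
  V_contDiff : ∀ i, ContDiffOn ℝ 1 (V i) (Metric.closedBall 0 ρ)
  V_zero : ∀ i, V i 0 = 0
  V_pos : ∀ i, ∀ ξ ∈ Metric.closedBall (0 : Euc (n i)) ρ, ξ ≠ 0 → 0 < V i ξ
  Λ_lipschitz : LocallyLipschitzOn (orthant N) Λ
  Λ_quasimonotone : QuasimonotoneOn Λ (orthant N)
  Λ_zero : Λ 0 = 0
  exists_control : ∀ i, ∀ y ∈ S.K i (Metric.closedBall 0 ρ) \ {0}, ∃ u, S.Admissible V Λ ρ i y u
  drift : ∀ i, ∀ x ∈ S.Ktilde ρ i 0 \ {0}, dirDeriv V ρ i x (S.f i x) < Λ (vectorV V x) i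
  comparison : IsAsymptoticallyStable Λ (orthant N)

/-- The decentralized small control property (with respect to `V`, `Λ`, `S_ρ`). -/
def SmallControlProperty (S : CompositeSystem n m l) (V : ∀ i, Euc (n i) → ℝ)
    (Λ : Euc N → Euc N) (ρ : ℝ) : Prop :=
  ∀ i, ∃ μ : Euc (l i) → ℝ, Continuous μ ∧ μ 0 = 0 ∧ (∀ y, y ≠ 0 → 0 < μ y) ∧
    ∀ y ∈ S.K i (Metric.closedBall 0 ρ) \ {0}, ∃ u, ‖u‖ < μ y ∧ S.Admissible V Λ ρ i y u

/-- The closed-loop vector field under the decentralized output feedback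
`u_i = Γ_i(h_i(x_i))`. -/
def closedLoop (S : CompositeSystem n m l) (Γ : ∀ i, Euc (l i) → Euc (m i))
    (x : StateSpace n) : StateSpace n :=
  WithLp.toLp 2 fun i => S.f i x + S.g i x (Γ i (S.h i (x i)))

end CompositeSystem

/-!
The feedback is chosen subsystem by subsystem. The set of admissible controls for an output value
`y` is convex, because the defining inequality is affine in the control, and an admissible control
for `y` stays admissible for all nearby outputs, because the inequality is strict and the fibres of
`h_i` over the closed ball are compact. A partition of unity therefore gives a continuous admissible
selection `Γ_i` on `{y ≠ 0}` with `‖Γ_i y‖ < μ_i y`; the bound by `μ_i` makes its extension by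
`Γ_i 0 = 0` continuous (`CompositeSystem.IsOCVLF.exists_feedback`).

Along the closed loop, `V` then satisfies the differential inequality `V̇ ≤ Λ(V)` componentwise, so
that `V` is a vector Lyapunov function. By quasimonotonicity and the local Lipschitz property,
`V(x(t))` stays below the solution of `ż = Λ(z)` with the same initial value, as long as `x` is in
the ball (`le_of_deriv_le_quasimonotone`). Since the comparison system is asymptotically stable and
small values of `V` force small states, a first-exit argument gives stability, and letting `t → ∞`
gives attractivity.

The closed-loop field is merely continuous, so that the existence and continuation of solutions
rest on Peano's theorem, which is proved for bounded continuous fields with an Euler scheme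
(`exists_solution_of_continuous_of_bounded`).
-/

/-! ### Existence of solutions for bounded continuous vector fields -/

/-- Global version of Peano's theorem. The solution is the pointwise limit, along a non-principal
ultrafilter, of the step functions `t ↦ a_k ⌊t k⌋` built from the Euler sequences `a_k` with step
size `1 / k`. -/
theorem exists_solution_of_continuous_of_bounded {E : Type*} [NormedAddCommGroup E]
    [NormedSpace ℝ E] [FiniteDimensional ℝ E] {F : E → E} (hF : Continuous F) {M : ℝ}
    (hM : ∀ x, ‖F x‖ ≤ M) (x₀ : E) :
    ∃ x : ℝ → E, x 0 = x₀ ∧ IsSolutionOn F univ x (Ici 0) := by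
  have : ProperSpace E := FiniteDimensional.proper ℝ E
  have hM0 : 0 ≤ M := (norm_nonneg _).trans (hM x₀)
  -- the Euler sequences with step size `1 / k`
  let a : ℕ → ℕ → E := fun k j => Nat.rec x₀ (fun _ p => p + (1 / (k : ℝ)) • F p) j
  have ha0 : ∀ k, a k 0 = x₀ := fun k => rfl
  have has : ∀ k j, a k (j + 1) = a k j + (1 / (k : ℝ)) • F (a k j) := fun k j => rfl
  -- the increment from index `p` to `q` is close to `(q - p) / k • w` if the field is close to `w`
  have hstep : ∀ k p (w : E) (c : ℝ) q, p ≤ q → (∀ j, p ≤ j → j < q → ‖F (a k j) - w‖ ≤ c) →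
      ‖a k q - a k p - (((q : ℝ) - p) / k) • w‖ ≤ ((q : ℝ) - p) / k * c := by
    intro k p w c q hpq
    induction q, hpq using Nat.le_induction with
    | base => intro _; simp
    | succ q hpq ih =>
      intro h
      have h1 := ih fun j hj hj' => h j hj (by omega)
      have h2 : ‖(1 / (k : ℝ)) • (F (a k q) - w)‖ ≤ 1 / k * c := by
        rw [norm_smul, Real.norm_of_nonneg (by positivity)]
        exact mul_le_mul_of_nonneg_left (h q hpq (by omega)) (by positivity)
      have h3 : a k (q + 1) - a k p - ((((q + 1 : ℕ) : ℝ) - p) / k) • w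
          = (a k q - a k p - (((q : ℝ) - p) / k) • w) + (1 / (k : ℝ)) • (F (a k q) - w) := by
        rw [has]; push_cast; module
      rw [h3]
      refine (norm_add_le _ _).trans ((add_le_add h1 h2).trans (le_of_eq ?_))
      push_cast; ring
  have hlip : ∀ k p q, p ≤ q → ‖a k q - a k p‖ ≤ ((q : ℝ) - p) / k * M := by
    intro k p q hpq
    simpa using hstep k p 0 M q hpq fun j _ _ => by simpa using hM _
  have hfl : ∀ t : ℝ, 0 ≤ t → Tendsto (fun k : ℕ => (⌊t * k⌋₊ : ℝ) / k) atTop (𝓝 t) :=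
    fun t ht => (tendsto_nat_floor_mul_div_atTop ht).comp tendsto_natCast_atTop_atTop
  let U : Ultrafilter ℕ := Ultrafilter.of atTop
  have hU : (U : Filter ℕ) ≤ atTop := Ultrafilter.of_le _
  have hex : ∀ t : ℝ, ∃ y : E, 0 ≤ t → Tendsto (fun k : ℕ => a k ⌊t * k⌋₊) U (𝓝 y) := by
    intro t
    by_cases ht : 0 ≤ t
    · have hmem : ∀ k : ℕ, a k ⌊t * k⌋₊ ∈ Metric.closedBall x₀ (t * M) := by
        intro k
        rw [mem_closedBall_iff_norm]
        have h := hlip k 0 ⌊t * k⌋₊ (Nat.zero_le _)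
        rw [ha0] at h
        refine h.trans (mul_le_mul_of_nonneg_right ?_ hM0)
        rcases Nat.eq_zero_or_pos k with rfl | hk
        · simpa using ht
        · have hk' : (0 : ℝ) < k := by exact_mod_cast hk
          rw [div_le_iff₀ hk']
          simpa using Nat.floor_le (mul_nonneg ht hk'.le)
      obtain ⟨y, -, hy⟩ := (isCompact_closedBall x₀ (t * M)).ultrafilter_le_nhds
        (U.map fun k : ℕ => a k ⌊t * k⌋₊)
        (le_principal_iff.2 (Filter.mem_map.2 (Eventually.of_forall hmem)))
      exact ⟨y, fun _ => hy⟩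
    · exact ⟨0, fun h => absurd h ht⟩
  choose x hx using hex
  -- the limit of the previous estimate: `x` has derivative `F (x t)` at `t`, in a two-point form
  have hkey : ∀ t, 0 ≤ t → ∀ ε > 0, ∃ δ > 0, ∀ r s, 0 ≤ r → r ≤ s → |r - t| < δ → |s - t| < δ →
      ‖x s - x r - (s - r) • F (x t)‖ ≤ (s - r) * ε := by
    intro t ht ε hε
    obtain ⟨δ₀, hδ₀, hF₀⟩ := Metric.continuousAt_iff.1 (hF.continuousAt (x := x t)) ε hε
    refine ⟨δ₀ / (4 * (M + 1)), by positivity, fun r s hr hrs hrt hst => ?_⟩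
    have hs := hr.trans hrs
    have hlim : Tendsto (fun k : ℕ => a k ⌊s * k⌋₊ - a k ⌊r * k⌋₊ -
        (((⌊s * k⌋₊ : ℝ) - ⌊r * k⌋₊) / k) • F (x t)) U (𝓝 (x s - x r - (s - r) • F (x t))) := by
      refine ((hx s hs).sub (hx r hr)).sub (Tendsto.smul_const ?_ _)
      simp_rw [sub_div]
      exact ((hfl s hs).sub (hfl r hr)).mono_left hU
    have hlim' : Tendsto (fun k : ℕ => ((⌊s * k⌋₊ : ℝ) - ⌊r * k⌋₊) / k * ε) U
        (𝓝 ((s - r) * ε)) := by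
      refine Tendsto.mul_const _ ?_
      simp_rw [sub_div]
      exact ((hfl s hs).sub (hfl r hr)).mono_left hU
    have hd : 0 < δ₀ / (4 * (M + 1)) := by positivity
    have e1 : ∀ᶠ k : ℕ in U, ‖a k ⌊t * k⌋₊ - x t‖ < δ₀ / 2 := by
      simpa [dist_eq_norm] using (Metric.tendsto_nhds.1 (hx t ht)) (δ₀ / 2) (by positivity)
    have e2 : ∀ y, 0 ≤ y → |y - t| < δ₀ / (4 * (M + 1)) → ∀ᶠ k : ℕ in (U : Filter ℕ),
        |(⌊y * k⌋₊ : ℝ) / k - (⌊t * k⌋₊ : ℝ) / k| < δ₀ / (4 * (M + 1)) := fun y hy hyt =>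
      ((((hfl y hy).sub (hfl t ht)).abs).mono_left hU).eventually_lt_const hyt
    refine le_of_tendsto_of_tendsto hlim.norm hlim' ?_
    filter_upwards [e1, e2 r hr hrt, e2 s hs hst] with k h1 h2 h3
    have hfloor : ⌊r * (k : ℝ)⌋₊ ≤ ⌊s * (k : ℝ)⌋₊ :=
      Nat.floor_mono (mul_le_mul_of_nonneg_right hrs (Nat.cast_nonneg _))
    refine hstep k _ _ _ _ hfloor fun j hj hj' => ?_
    have hjr : (⌊r * (k : ℝ)⌋₊ : ℝ) / k ≤ (j : ℝ) / k := by gcongr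
    have hjs : (j : ℝ) / k ≤ (⌊s * (k : ℝ)⌋₊ : ℝ) / k := by gcongr
    rw [abs_lt] at h2 h3
    -- Euler points with index between `⌊r k⌋` and `⌊s k⌋` are close to `x t`, so the field there
    -- is within `ε` of `F (x t)`
    have hclose : ‖a k j - a k ⌊t * k⌋₊‖ ≤ δ₀ / (4 * (M + 1)) * M := by
      rcases le_total j ⌊t * (k : ℝ)⌋₊ with hjt | hjt
      · rw [norm_sub_rev]
        refine (hlip k _ _ hjt).trans (mul_le_mul_of_nonneg_right ?_ hM0)
        rw [sub_div]; linarith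
      · refine (hlip k _ _ hjt).trans (mul_le_mul_of_nonneg_right ?_ hM0)
        rw [sub_div]; linarith
    have hsmall : δ₀ / (4 * (M + 1)) * M ≤ δ₀ / 4 := by
      rw [div_mul_eq_mul_div, div_le_div_iff₀ (by positivity) (by positivity)]
      nlinarith
    have hdist : dist (a k j) (x t) < δ₀ := by
      rw [dist_eq_norm]
      calc ‖a k j - x t‖ ≤ ‖a k j - a k ⌊t * k⌋₊‖ + ‖a k ⌊t * k⌋₊ - x t‖ :=
            norm_sub_le_norm_sub_add_norm_sub _ _ _
        _ < δ₀ := by linarith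
    simpa [dist_eq_norm] using (hF₀ hdist).le
  refine ⟨x, ?_, fun t ht => ⟨mem_univ _, ?_⟩⟩
  · refine tendsto_nhds_unique (hx 0 le_rfl) ?_
    simp [ha0]
  · rw [hasDerivWithinAt_iff_isLittleO, Asymptotics.isLittleO_iff]
    intro ε hε
    obtain ⟨δ, hδ, h⟩ := hkey t ht ε hε
    filter_upwards [self_mem_nhdsWithin, mem_nhdsWithin_of_mem_nhds (Metric.ball_mem_nhds t hδ)]
      with s hs hst
    rw [Metric.mem_ball, Real.dist_eq] at hst
    rw [Real.norm_eq_abs]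
    rcases le_total t s with hts | hts
    · rw [abs_of_nonneg (sub_nonneg.2 hts), mul_comm]
      exact h t s ht hts (by simpa using hδ) hst
    · rw [abs_of_nonpos (sub_nonpos.2 hts), mul_comm, neg_sub]
      rw [show x s - x t - (s - t) • F (x t) = -(x t - x s - (t - s) • F (x t)) by module,
        norm_neg]
      exact h s t hs hts hst (by simpa using hδ)

theorem IsSolutionOn.mono {E : Type*} [NormedAddCommGroup E] [NormedSpace ℝ E] {F : E → E}
    {D : Set E} {x : ℝ → E} {I J : Set ℝ} (h : IsSolutionOn F D x I) (hJ : J ⊆ I) :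
    IsSolutionOn F D x J :=
  fun t ht => ⟨(h t (hJ ht)).1, (h t (hJ ht)).2.mono hJ⟩

theorem IsSolutionOn.continuousOn {E : Type*} [NormedAddCommGroup E] [NormedSpace ℝ E] {F : E → E}
    {D : Set E} {x : ℝ → E} {I : Set ℝ} (h : IsSolutionOn F D x I) : ContinuousOn x I :=
  fun t ht => (h t ht).2.continuousWithinAt

/-- Concatenation of a solution on `[0, T]` with a solution starting where the first one ends. -/
theorem IsSolutionOn.concat {E : Type*} [NormedAddCommGroup E] [NormedSpace ℝ E] {F : E → E}
    {D : Set E} {x y : ℝ → E} {T : ℝ} (hT : 0 ≤ T) (hx : IsSolutionOn F D x (Icc 0 T))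
    (hy : IsSolutionOn F D y (Ici 0)) (h : y 0 = x T) :
    IsSolutionOn F D (fun t => if t ≤ T then x t else y (t - T)) (Ici 0) := by
  intro t ht
  set w : ℝ → E := fun t => if t ≤ T then x t else y (t - T) with hw
  have hw1 : ∀ s ∈ Icc 0 T, w s = x s := fun s hs => by simp [hw, hs.2]
  have hw2 : ∀ s ∈ Ici T, w s = y (s - T) := fun s hs => by
    rcases eq_or_lt_of_le (mem_Ici.1 hs) with rfl | hs
    · simp [hw, h]
    · simp [hw, hs]
  have h1 : t ∈ Icc 0 T → HasDerivWithinAt w (F (w t)) (Icc 0 T) t := fun ht' => by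
    rw [hw1 t ht']
    exact (hx t ht').2.congr hw1 (hw1 t ht')
  have h2 : t ∈ Ici T → HasDerivWithinAt w (F (w t)) (Ici T) t := fun ht' => by
    rw [hw2 t ht']
    have h3 := (hy (t - T) (by simpa using ht')).2.scomp t
      ((hasDerivAt_id t).sub_const T).hasDerivWithinAt
      (fun s (hs : s ∈ Ici T) => by simpa using hs : MapsTo (fun s => id s - T) (Ici T) (Ici 0))
    rw [one_smul] at h3
    exact h3.congr hw2 (hw2 t ht')
  rw [← Icc_union_Ici_eq_Ici hT]
  rcases lt_trichotomy t T with htT | rfl | htT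
  · have ht' : t ∈ Icc 0 T := ⟨ht, htT.le⟩
    refine ⟨by simpa only [hw1 t ht'] using (hx t ht').1, (h1 ht').union ?_⟩
    exact hasDerivWithinAt_iff_hasFDerivWithinAt.2 (.of_notMem_closure (by simpa using htT))
  · have ht' : t ∈ Icc 0 t := ⟨ht, le_rfl⟩
    exact ⟨by simpa only [hw1 t ht'] using (hx t ht').1, (h1 ht').union (h2 self_mem_Ici)⟩
  · refine ⟨by simpa only [hw2 t htT.le] using (hy _ (by simpa using htT.le)).1,
      HasDerivWithinAt.union ?_ (h2 htT.le)⟩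
    exact hasDerivWithinAt_iff_hasFDerivWithinAt.2 (.of_notMem_closure (by simp [htT]))

/-! ### Comparison of differential inequalities with quasimonotone systems -/

theorem hasDerivAt_max_zero_sq (w : ℝ) :
    HasDerivAt (fun w : ℝ => max w 0 ^ 2) (2 * max w 0) w := by
  have hpos : ∀ w ∈ Ici (0 : ℝ), HasDerivWithinAt (fun w : ℝ => max w 0 ^ 2) (2 * max w 0)
      (Ici 0) w := fun w hw => by
    have h := (hasDerivAt_pow 2 w).hasDerivWithinAt (s := Ici 0)
    have h' := h.congr (f₁ := fun w : ℝ => max w 0 ^ 2)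
      (fun y hy => by simp [max_eq_left (mem_Ici.1 hy)]) (by simp [max_eq_left (mem_Ici.1 hw)])
    simpa [max_eq_left (mem_Ici.1 hw)] using h'
  have hneg : ∀ w ∈ Iic (0 : ℝ), HasDerivWithinAt (fun w : ℝ => max w 0 ^ 2) (2 * max w 0)
      (Iic 0) w := fun w hw => by
    have h := (hasDerivWithinAt_const w (Iic (0 : ℝ)) (0 : ℝ))
    have h' := h.congr (f₁ := fun w : ℝ => max w 0 ^ 2)
      (fun y hy => by simp [max_eq_right (mem_Iic.1 hy)]) (by simp [max_eq_right (mem_Iic.1 hw)])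
    simpa [max_eq_right (mem_Iic.1 hw)] using h'
  rw [← hasDerivWithinAt_univ, ← Iic_union_Ici (a := (0 : ℝ))]
  rcases lt_trichotomy w 0 with h | rfl | h
  · exact (hneg w h.le).union (hasDerivWithinAt_iff_hasFDerivWithinAt.2
      (.of_notMem_closure (by simpa using h)))
  · exact (hneg 0 self_mem_Iic).union (hpos 0 self_mem_Ici)
  · exact (hasDerivWithinAt_iff_hasFDerivWithinAt.2
      (.of_notMem_closure (by simpa using h))).union (hpos w h.le)

/-- Comparison principle: a function `v` with `v' ≤ Λ(v)` componentwise lies below the solution `z`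
of `ż = Λ(z)` if it does so initially. With `p = max(v, z) - z`, quasimonotonicity bounds the
derivative of `v_i - z_i` by `Λ_i(max(v, z)) - Λ_i(z)` wherever `p_i > 0`, so that `‖p‖²`
satisfies a linear differential inequality with zero initial value. -/
theorem le_of_deriv_le_quasimonotone {N : ℕ} {Λ : Euc N → Euc N}
    (hlip : LocallyLipschitzOn (orthant N) Λ) (hq : QuasimonotoneOn Λ (orthant N)) {T : ℝ}
    {v z : ℝ → Euc N} {v' : ℝ → Fin N → ℝ} (hz : IsSolutionOn Λ (orthant N) z (Icc 0 T))
    (hv : ∀ t ∈ Icc 0 T, v t ∈ orthant N)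
    (hv' : ∀ t ∈ Icc 0 T, ∀ i, HasDerivWithinAt (fun s => v s i) (v' t i) (Icc 0 T) t)
    (hle : ∀ t ∈ Icc 0 T, ∀ i, v' t i ≤ Λ (v t) i) (h0 : ∀ i, v 0 i ≤ z 0 i) :
    ∀ t ∈ Icc 0 T, ∀ i, v t i ≤ z t i := by
  have hz' : ∀ t ∈ Icc 0 T, ∀ i, HasDerivWithinAt (fun s => z s i) (Λ (z t) i) (Icc 0 T) t :=
    fun t ht i => (EuclideanSpace.proj (𝕜 := ℝ) i).hasFDerivAt.comp_hasDerivWithinAt t (hz t ht).2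
  let m : ℝ → Euc N := fun t => WithLp.toLp 2 fun i => max (v t i) (z t i)
  have hmc : ContinuousOn m (Icc 0 T) := by
    refine (PiLp.continuous_toLp 2 _).comp_continuousOn (continuousOn_pi.2 fun i => ?_)
    exact ContinuousOn.sup (fun t ht => (hv' t ht i).continuousWithinAt)
      (fun t ht => (hz' t ht i).continuousWithinAt)
  have hmo : ∀ t ∈ Icc 0 T, m t ∈ orthant N := fun t ht i => le_max_of_le_left (hv t ht i)
  obtain ⟨K, hK⟩ := (hlip.mono (t := orthant N) (s := z '' Icc 0 T ∪ m '' Icc 0 T) (by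
    rintro _ (⟨t, ht, rfl⟩ | ⟨t, ht, rfl⟩)
    exacts [(hz t ht).1, hmo t ht])).exists_lipschitzOnWith_of_compact
    ((isCompact_Icc.image_of_continuousOn hz.continuousOn).union
      (isCompact_Icc.image_of_continuousOn hmc))
  let Φ : ℝ → ℝ := fun t => ∑ i, max (v t i - z t i) 0 ^ 2
  let Φ' : ℝ → ℝ := fun t => ∑ i, 2 * max (v t i - z t i) 0 * (v' t i - Λ (z t) i)
  have hmz : ∀ t i, (m t - z t) i = max (v t i - z t i) 0 := fun t i => by
    change max (v t i) (z t i) - z t i = _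
    rw [← max_sub_sub_right, sub_self]
  have hΦ : ∀ t, Φ t = ‖m t - z t‖ ^ 2 := fun t => by
    simp only [EuclideanSpace.norm_sq_eq, hmz, Real.norm_eq_abs, sq_abs, Φ]
  have hd : ∀ t ∈ Icc 0 T, HasDerivWithinAt Φ (Φ' t) (Icc 0 T) t := fun t ht =>
    HasDerivWithinAt.fun_sum fun i _ =>
      (hasDerivAt_max_zero_sq _).comp_hasDerivWithinAt t ((hv' t ht i).sub (hz' t ht i))
  have hbound : ∀ t ∈ Icc 0 T, Φ' t ≤ (N * (2 * K)) * Φ t + 0 := by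
    intro t ht
    have hi : ∀ i, 2 * max (v t i - z t i) 0 * (v' t i - Λ (z t) i) ≤ 2 * K * Φ t := by
      intro i
      rcases le_total (v t i) (z t i) with hvz | hvz
      · rw [max_eq_right (sub_nonpos.2 hvz), hΦ]
        have := K.2
        simp only [mul_zero, zero_mul]
        positivity
      · have h1 : Λ (v t) i ≤ Λ (m t) i := hq i _ (hv t ht) _ (hmo t ht)
          (max_eq_left hvz).symm fun j => le_max_left _ _
        have h2 : Λ (m t) i - Λ (z t) i ≤ K * ‖m t - z t‖ := by
          calc Λ (m t) i - Λ (z t) i = (Λ (m t) - Λ (z t)) i := rfl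
            _ ≤ ‖(Λ (m t) - Λ (z t)) i‖ := Real.le_norm_self _
            _ ≤ ‖Λ (m t) - Λ (z t)‖ := PiLp.norm_apply_le _ _
            _ ≤ K * ‖m t - z t‖ := by
              simpa only [dist_eq_norm] using hK.dist_le_mul (m t) (Or.inr ⟨t, ht, rfl⟩)
                (z t) (Or.inl ⟨t, ht, rfl⟩)
        have h3 : max (v t i - z t i) 0 ≤ ‖m t - z t‖ := by
          rw [← hmz]
          exact (Real.le_norm_self _).trans (PiLp.norm_apply_le _ _)
        have h4 : 0 ≤ max (v t i - z t i) 0 := le_max_right _ _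
        have h5 := hle t ht i
        have h6 : 0 ≤ (K : ℝ) * ‖m t - z t‖ := by positivity
        calc 2 * max (v t i - z t i) 0 * (v' t i - Λ (z t) i)
            ≤ 2 * max (v t i - z t i) 0 * (K * ‖m t - z t‖) :=
              mul_le_mul_of_nonneg_left (by linarith) (by positivity)
          _ ≤ 2 * ‖m t - z t‖ * (K * ‖m t - z t‖) :=
              mul_le_mul_of_nonneg_right (by linarith) h6
          _ = 2 * K * Φ t := by rw [hΦ]; ring
    calc Φ' t ≤ ∑ _i : Fin N, 2 * K * Φ t := Finset.sum_le_sum fun i _ => hi i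
      _ = (N * (2 * K)) * Φ t + 0 := by simp; ring
  have hΦ0 : Φ 0 ≤ 0 := le_of_eq <| Finset.sum_eq_zero fun i _ => by
    rw [max_eq_right (sub_nonpos.2 (h0 i)), zero_pow two_ne_zero]
  have hmain := le_gronwallBound_of_liminf_deriv_right_le
    (fun t ht => (hd t ht).continuousWithinAt)
    (fun t ht r hr => ((hd t (Ico_subset_Icc_self ht)).mono_of_mem_nhdsWithin
      (Icc_mem_nhdsGE_of_mem ht)).liminf_right_slope_le hr) hΦ0
    (fun t ht => hbound t (Ico_subset_Icc_self ht))
  intro t ht i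
  have h1 := hmain t ht
  rw [gronwallBound_ε0_δ0] at h1
  have h2 : max (v t i - z t i) 0 ^ 2 ≤ Φ t :=
    Finset.single_le_sum (f := fun i => max (v t i - z t i) 0 ^ 2) (fun i _ => sq_nonneg _)
      (Finset.mem_univ i)
  have h3 : max (v t i - z t i) 0 = 0 := pow_eq_zero_iff two_ne_zero |>.1
    (le_antisymm (h2.trans h1) (sq_nonneg _))
  have h4 := le_max_left (v t i - z t i) 0
  linarith

/-! ### Vector Lyapunov functions -/

/-- `W` is a vector Lyapunov function on the closed ball of radius `ρ` for the vector field `F`,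
with comparison function `Λ`: it takes values in the orthant, vanishes exactly at `0`, and its
components satisfy `Ẇ_i ≤ Λ_i(W)` along `F`. -/
structure IsVectorLyapunov {E : Type*} [NormedAddCommGroup E] [NormedSpace ℝ E] {N : ℕ}
    (F : E → E) (W : E → Euc N) (Λ : Euc N → Euc N) (ρ : ℝ) : Prop where
  continuousOn : ContinuousOn W (Metric.closedBall 0 ρ)
  mem_orthant : ∀ x ∈ Metric.closedBall 0 ρ, W x ∈ orthant N
  zero : W 0 = 0
  eq_zero : ∀ x ∈ Metric.closedBall 0 ρ, W x = 0 → x = 0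
  deriv_le : ∀ x ∈ Metric.closedBall 0 ρ, ∀ i, ∃ L : E →L[ℝ] ℝ,
    HasFDerivWithinAt (fun x => W x i) L (Metric.closedBall 0 ρ) x ∧ L (F x) ≤ Λ (W x) i

namespace IsVectorLyapunov

variable {E : Type*} [NormedAddCommGroup E] [NormedSpace ℝ E] {N : ℕ}
  {F : E → E} {W : E → Euc N} {Λ : Euc N → Euc N} {ρ : ℝ}

theorem congr (hW : IsVectorLyapunov F W Λ ρ) {F' : E → E}
    (h : EqOn F' F (Metric.closedBall 0 ρ)) : IsVectorLyapunov F' W Λ ρ where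
  continuousOn := hW.continuousOn
  mem_orthant := hW.mem_orthant
  zero := hW.zero
  eq_zero := hW.eq_zero
  deriv_le x hx i := by
    rw [h hx]
    exact hW.deriv_le x hx i

/-- `W` is proper at its zero: small values of `W` on the ball force small arguments. -/
theorem exists_norm_lt [ProperSpace E] (hW : IsVectorLyapunov F W Λ ρ) {ε : ℝ} (hε : 0 < ε) :
    ∃ η > 0, ∀ x ∈ Metric.closedBall 0 ρ, ‖W x‖ < η → ‖x‖ < ε := by
  have hA : IsCompact (Metric.closedBall (0 : E) ρ ∩ {x | ε ≤ ‖x‖}) :=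
    (isCompact_closedBall 0 ρ).inter_right (isClosed_le continuous_const continuous_norm)
  rcases (Metric.closedBall (0 : E) ρ ∩ {x | ε ≤ ‖x‖}).eq_empty_or_nonempty with hne | hne
  · refine ⟨1, one_pos, fun x hx _ => not_le.1 fun h => ?_⟩
    exact (eq_empty_iff_forall_notMem.1 hne x) ⟨hx, h⟩
  · obtain ⟨p, hp, hmin⟩ := hA.exists_isMinOn hne (hW.continuousOn.norm.mono inter_subset_left)
    refine ⟨‖W p‖, norm_pos_iff.2 fun h => ?_, fun x hx hlt => not_le.1 fun h =>
      hlt.not_ge (hmin ⟨hx, h⟩)⟩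
    have := hp.2
    rw [hW.eq_zero p hp.1 h] at this
    exact hε.not_ge (this.trans_eq norm_zero)

/-- As long as a solution of `ẋ = F(x)` stays in the ball, `W` along it is dominated by the
solution of the comparison system. -/
theorem norm_le (hW : IsVectorLyapunov F W Λ ρ) (hlip : LocallyLipschitzOn (orthant N) Λ)
    (hq : QuasimonotoneOn Λ (orthant N)) {T : ℝ} {x : ℝ → E} {z : ℝ → Euc N}
    (hx : IsSolutionOn F univ x (Icc 0 T)) (hxρ : ∀ t ∈ Icc 0 T, ‖x t‖ ≤ ρ)
    (hz : IsSolutionOn Λ (orthant N) z (Icc 0 T)) (h0 : z 0 = W (x 0)) :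
    ∀ t ∈ Icc 0 T, ‖W (x t)‖ ≤ ‖z t‖ := by
  have hmem : MapsTo x (Icc 0 T) (Metric.closedBall 0 ρ) := fun t ht => by
    simpa using hxρ t ht
  have hd : ∀ t i, ∃ d : ℝ, t ∈ Icc 0 T →
      HasDerivWithinAt (fun s => W (x s) i) d (Icc 0 T) t ∧ d ≤ Λ (W (x t)) i := by
    intro t i
    by_cases ht : t ∈ Icc 0 T
    · obtain ⟨L, hL, hle⟩ := hW.deriv_le _ (hmem ht) i
      exact ⟨L (F (x t)), fun _ => ⟨hL.comp_hasDerivWithinAt t (hx t ht).2 hmem, hle⟩⟩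
    · exact ⟨0, fun h => absurd h ht⟩
  choose d hd using hd
  have hle := le_of_deriv_le_quasimonotone hlip hq (v := fun t => W (x t)) hz
    (fun t ht => hW.mem_orthant _ (hmem ht)) (fun t ht i => (hd t i ht).1)
    (fun t ht i => (hd t i ht).2) (fun i => by rw [h0])
  intro t ht
  rw [EuclideanSpace.norm_eq, EuclideanSpace.norm_eq]
  refine Real.sqrt_le_sqrt (Finset.sum_le_sum fun i _ => ?_)
  have h1 := hW.mem_orthant _ (hmem ht) i
  rw [Real.norm_of_nonneg h1, Real.norm_of_nonneg (h1.trans (hle t ht i))]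
  exact pow_le_pow_left₀ h1 (hle t ht i) 2

/-- Near the origin the comparison system has a solution that starts at `W x₀`, and this initial
value is as small as desired. -/
theorem exists_comparison_solution (hW : IsVectorLyapunov F W Λ ρ) (hρ : 0 < ρ)
    (hΛ : IsAsymptoticallyStable Λ (orthant N)) {r : ℝ} (hr : 0 < r) :
    ∃ δ > 0, ∀ x₀ : E, ‖x₀‖ < δ → ‖W x₀‖ < r ∧
      ∃ z : ℝ → Euc N, z 0 = W x₀ ∧ IsSolutionOn Λ (orthant N) z (Ici 0) := by
  obtain ⟨δ₁, hδ₁, hc⟩ := hΛ.continuable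
  have hcont : ContinuousAt W 0 :=
    hW.continuousOn.continuousAt (Metric.closedBall_mem_nhds 0 hρ)
  obtain ⟨δ, hδ, h⟩ := Metric.continuousAt_iff.1 hcont (min r δ₁) (lt_min hr hδ₁)
  refine ⟨min δ ρ, lt_min hδ hρ, fun x₀ hx₀ => ?_⟩
  have h1 : ‖W x₀‖ < min r δ₁ := by
    simpa [hW.zero] using h (x := x₀) (by simpa using hx₀.trans_le (min_le_left _ _))
  have h2 : x₀ ∈ Metric.closedBall 0 ρ := by simpa using (hx₀.trans_le (min_le_right _ _)).le
  -- every initial value is a solution on the degenerate interval `[0, 0]`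
  obtain ⟨z, hz, hz'⟩ := hc 0 le_rfl (fun _ => W x₀)
    (fun t ht => ⟨hW.mem_orthant _ h2, by
      rw [Icc_self, mem_singleton_iff] at ht
      subst ht
      rw [Icc_self]
      exact hasDerivWithinAt_iff_hasFDerivWithinAt.2
        (.of_subsingleton subsingleton_singleton)⟩)
    (h1.trans_le (min_le_right _ _))
  exact ⟨h1.trans_le (min_le_left _ _), z, hz (by simp), hz'⟩

theorem stable [ProperSpace E] (hW : IsVectorLyapunov F W Λ ρ) (hρ : 0 < ρ)
    (hlip : LocallyLipschitzOn (orthant N) Λ) (hq : QuasimonotoneOn Λ (orthant N))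
    (hΛ : IsAsymptoticallyStable Λ (orthant N)) {ε : ℝ} (hε : 0 < ε) :
    ∃ δ > 0, ∀ T : ℝ, 0 ≤ T → ∀ x : ℝ → E, IsSolutionOn F univ x (Icc 0 T) →
      ‖x 0‖ < δ → ∀ t ∈ Icc 0 T, ‖x t‖ < ε := by
  wlog hερ : ε ≤ ρ generalizing ε
  · obtain ⟨δ, hδ, h⟩ := this hρ le_rfl
    exact ⟨δ, hδ, fun T hT x hx h0 t ht => (h T hT x hx h0 t ht).trans (not_le.1 hερ)⟩
  obtain ⟨η, hη, hηε⟩ := hW.exists_norm_lt hε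
  obtain ⟨r, hr, hrη⟩ := hΛ.stable η hη
  obtain ⟨δ, hδ, hδr⟩ := hW.exists_comparison_solution hρ hΛ hr
  refine ⟨min δ ε, lt_min hδ hε, fun T hT x hx h0 => ?_⟩
  by_contra! hcon
  -- `τ` is the first time at which the solution leaves the open ball of radius `ε`
  have hcpt : IsCompact (Icc 0 T ∩ {t | ε ≤ ‖x t‖}) :=
    isCompact_Icc.of_isClosed_subset
      (hx.continuousOn.norm.preimage_isClosed_of_isClosed isClosed_Icc isClosed_Ici)
      inter_subset_left
  obtain ⟨τ, ⟨hτT, hτε⟩, hleast⟩ := hcpt.exists_isLeast (by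
    obtain ⟨t, ht, h⟩ := hcon
    exact ⟨t, ht, h⟩)
  have hsub : Icc 0 τ ⊆ Icc 0 T := Icc_subset_Icc_right hτT.2
  have hτ : ‖x τ‖ = ε := by
    obtain ⟨s, hs, hsε⟩ := intermediate_value_Icc hτT.1 (hx.continuousOn.norm.mono hsub)
      ⟨(h0.trans_le (min_le_right _ _)).le, hτε⟩
    have hτs : τ ≤ s := hleast ⟨hsub hs, hsε.ge⟩
    rwa [le_antisymm hτs hs.2]
  have hball : ∀ t ∈ Icc 0 τ, ‖x t‖ ≤ ρ := by
    intro t ht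
    refine le_trans (not_lt.1 fun h => ?_) hερ
    have hτt : τ ≤ t := hleast ⟨hsub ht, h.le⟩
    rw [le_antisymm ht.2 hτt, hτ] at h
    exact lt_irrefl _ h
  obtain ⟨hWr, z, hz0, hz⟩ := hδr (x 0) (h0.trans_le (min_le_left _ _))
  have hzτ := hz.mono (Icc_subset_Ici_self : Icc 0 τ ⊆ Ici 0)
  have hend : τ ∈ Icc 0 τ := ⟨hτT.1, le_rfl⟩
  have h1 := hW.norm_le hlip hq (hx.mono hsub) hball hzτ hz0 τ hend
  have h2 := hrη τ hτT.1 z hzτ (by rwa [hz0]) τ hend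
  have h3 := hηε (x τ) (by simpa using hball τ hend) (h1.trans_lt h2)
  exact h3.ne hτ

theorem attractive [ProperSpace E] (hW : IsVectorLyapunov F W Λ ρ) (hρ : 0 < ρ)
    (hlip : LocallyLipschitzOn (orthant N) Λ) (hq : QuasimonotoneOn Λ (orthant N))
    (hΛ : IsAsymptoticallyStable Λ (orthant N)) :
    ∃ δ > 0, ∀ x : ℝ → E, IsSolutionOn F univ x (Ici 0) → ‖x 0‖ < δ →
      Tendsto x atTop (𝓝 0) := by
  obtain ⟨r, hr, hrz⟩ := hΛ.attractive
  obtain ⟨δ₁, hδ₁, h₁⟩ := hW.exists_comparison_solution hρ hΛ hr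
  obtain ⟨δ₂, hδ₂, h₂⟩ := hW.stable hρ hlip hq hΛ hρ
  refine ⟨min δ₁ δ₂, lt_min hδ₁ hδ₂, fun x hx h0 => ?_⟩
  obtain ⟨hWr, z, hz0, hz⟩ := h₁ (x 0) (h0.trans_le (min_le_left _ _))
  have hball : ∀ t, 0 ≤ t → ‖x t‖ < ρ := fun t ht =>
    h₂ t ht x (hx.mono Icc_subset_Ici_self) (h0.trans_le (min_le_right _ _)) t ⟨ht, le_rfl⟩
  have hle : ∀ t, 0 ≤ t → ‖W (x t)‖ ≤ ‖z t‖ := fun t ht =>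
    hW.norm_le hlip hq (hx.mono Icc_subset_Ici_self) (fun s hs => (hball s hs.1).le)
      (hz.mono Icc_subset_Ici_self) hz0 t ⟨ht, le_rfl⟩
  have hz_lim := hrz z hz (by rwa [hz0])
  rw [Metric.tendsto_nhds]
  intro ε hε
  obtain ⟨η, hη, hηε⟩ := hW.exists_norm_lt hε
  filter_upwards [Metric.tendsto_nhds.1 hz_lim η hη, eventually_ge_atTop 0] with t ht ht0
  rw [dist_zero_right] at ht ⊢
  exact hηε _ (by simpa using (hball t ht0).le) ((hle t ht0).trans_lt ht)

/-- Solutions starting near `0` can be continued: after composing `F` with the radial retraction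
onto the ball it is bounded, so its solutions continue for all times, and by stability the continued
solution never leaves the ball, where the field is unchanged. -/
theorem continuable [FiniteDimensional ℝ E] (hW : IsVectorLyapunov F W Λ ρ) (hρ : 0 < ρ)
    (hF : Continuous F) (hlip : LocallyLipschitzOn (orthant N) Λ)
    (hq : QuasimonotoneOn Λ (orthant N)) (hΛ : IsAsymptoticallyStable Λ (orthant N)) :
    ∃ δ > 0, ∀ T : ℝ, 0 ≤ T → ∀ x : ℝ → E, IsSolutionOn F univ x (Icc 0 T) →
      ‖x 0‖ < δ → ∃ x' : ℝ → E, EqOn x' x (Icc 0 T) ∧ IsSolutionOn F univ x' (Ici 0) := by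
  have : ProperSpace E := FiniteDimensional.proper ℝ E
  let R : E → E := fun x => (ρ / max ρ ‖x‖) • x
  have hmax : ∀ x : E, 0 < max ρ ‖x‖ := fun x => hρ.trans_le (le_max_left _ _)
  have hRc : Continuous R :=
    (continuous_const.div (continuous_const.max continuous_norm) fun x => (hmax x).ne').smul
      continuous_id
  have hR : ∀ x, R x ∈ Metric.closedBall 0 ρ := fun x => by
    rw [mem_closedBall_zero_iff, norm_smul, Real.norm_of_nonneg (div_pos hρ (hmax x)).le,
      div_mul_eq_mul_div, div_le_iff₀ (hmax x)]
    exact mul_le_mul_of_nonneg_left (le_max_right _ _) hρ.le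
  have hRid : ∀ x, ‖x‖ ≤ ρ → R x = x := fun x hx => by
    simp only [R, max_eq_left hx, div_self hρ.ne', one_smul]
  obtain ⟨M, hM⟩ := (isCompact_closedBall (0 : E) ρ).exists_bound_of_continuousOn hF.continuousOn
  have hFR : ∀ x, ‖x‖ ≤ ρ → (F ∘ R) x = F x := fun x hx => congrArg F (hRid x hx)
  obtain ⟨δ₁, hδ₁, h₁⟩ := hW.stable hρ hlip hq hΛ hρ
  obtain ⟨δ₂, hδ₂, h₂⟩ := (hW.congr fun x hx => hFR x (by simpa using hx)).stable
    hρ hlip hq hΛ hρ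
  refine ⟨min δ₁ δ₂, lt_min hδ₁ hδ₂, fun T hT x hx h0 => ?_⟩
  have hxρ := h₁ T hT x hx (h0.trans_le (min_le_left _ _))
  have hx' : IsSolutionOn (F ∘ R) univ x (Icc 0 T) := fun t ht => by
    rw [hFR _ (hxρ t ht).le]
    exact hx t ht
  obtain ⟨y, hy0, hy⟩ := exists_solution_of_continuous_of_bounded (hF.comp hRc)
    (fun x => hM _ (hR x)) (x T)
  have hw := hx'.concat hT hy hy0
  refine ⟨fun t => if t ≤ T then x t else y (t - T), fun t ht => if_pos ht.2,
    fun t ht => ⟨mem_univ _, ?_⟩⟩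
  have hwρ := h₂ t ht _ (hw.mono Icc_subset_Ici_self)
    (by simpa only [if_pos hT] using h0.trans_le (min_le_right _ _)) t ⟨ht, le_rfl⟩
  rw [← hFR _ hwρ.le]
  exact (hw t ht).2

/-- A vector Lyapunov function with an asymptotically stable comparison system certifies asymptotic
stability. -/
theorem isAsymptoticallyStable [FiniteDimensional ℝ E] (hW : IsVectorLyapunov F W Λ ρ)
    (hρ : 0 < ρ) (hF : Continuous F) (hF0 : F 0 = 0) (hlip : LocallyLipschitzOn (orthant N) Λ)
    (hq : QuasimonotoneOn Λ (orthant N)) (hΛ : IsAsymptoticallyStable Λ (orthant N)) :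
    IsAsymptoticallyStable F univ :=
  have : ProperSpace E := FiniteDimensional.proper ℝ E
  { equilibrium := ⟨mem_univ _, hF0⟩
    stable := fun _ hε => hW.stable hρ hlip hq hΛ hε
    continuable := hW.continuable hρ hF hlip hq hΛ
    attractive := hW.attractive hρ hlip hq hΛ }

end IsVectorLyapunov

/-! ### Selection of the feedback -/

/-- Convex constraint sets that locally admit a constant selection of norm less than `μ` away from
`0` have a selection that is continuous everywhere, including the point `0`, where it vanishes. -/
theorem exists_continuous_selection_of_norm_lt {Y U : Type*} [NormedAddCommGroup Y]
    [NormedAddCommGroup U] [NormedSpace ℝ U] {A : Y → Set U} {μ : Y → ℝ} (hμ : Continuous μ)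
    (hμ0 : μ 0 = 0) (hconv : ∀ y, Convex ℝ (A y))
    (hloc : ∀ y ≠ 0, ∃ u, ‖u‖ < μ y ∧ ∀ᶠ y' in 𝓝 y, u ∈ A y') :
    ∃ Γ : Y → U, Continuous Γ ∧ Γ 0 = 0 ∧ ∀ y ≠ 0, Γ y ∈ A y := by
  classical
  obtain ⟨γ, hγ⟩ := exists_continuous_forall_mem_convex_of_local_const
    (X := {y : Y // y ≠ 0}) (t := fun y => A y ∩ Metric.ball 0 (μ y))
    (fun y => (hconv y).inter (convex_ball 0 _)) (fun y => by
      obtain ⟨u, hu, hev⟩ := hloc y y.2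
      refine ⟨u, ?_⟩
      have h1 := (continuous_subtype_val.tendsto y).eventually hev
      have h2 := (hμ.comp continuous_subtype_val).continuousAt.eventually_const_lt hu
      filter_upwards [h1, h2] with y' h h'
      exact ⟨h, by simpa using h'⟩)
  let Γ : Y → U := fun y => if h : y = 0 then 0 else γ ⟨y, h⟩
  have hΓ : ∀ y (h : y ≠ 0), Γ y = γ ⟨y, h⟩ := fun y h => dif_neg h
  have hΓ0 : Γ 0 = 0 := dif_pos rfl
  have hle : ∀ y, ‖Γ y‖ ≤ μ y := fun y => by
    rcases eq_or_ne y 0 with rfl | h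
    · rw [hΓ0, hμ0, norm_zero]
    · rw [hΓ y h]
      simpa using (mem_ball_zero_iff.1 (hγ ⟨y, h⟩).2).le
  refine ⟨Γ, continuous_iff_continuousAt.2 fun y => ?_, hΓ0, fun y h => ?_⟩
  · rcases eq_or_ne y 0 with rfl | h
    · rw [ContinuousAt, hΓ0]
      exact squeeze_zero_norm hle (by simpa [hμ0] using hμ.tendsto 0)
    · have hopen : IsOpen {y : Y | y ≠ 0} := isOpen_ne
      refine ContinuousOn.continuousAt (s := {y : Y | y ≠ 0}) ?_ (hopen.mem_nhds h)
      rw [continuousOn_iff_continuous_domRestrict]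
      exact γ.continuous.congr fun y => (hΓ y y.2).symm
  · rw [hΓ y h]
    exact (hγ ⟨y, h⟩).1

/-- A strict inequality on a fibre of a continuous map over a compact set persists on the
neighbouring fibres. It holds vacuously near a value that is not attained. -/
theorem IsCompact.eventually_forall_fiber_neg {X Y : Type*} [TopologicalSpace X]
    [TopologicalSpace Y] [T2Space Y] {B : Set X} (hB : IsCompact B) (hBc : IsClosed B)
    {φ : X → Y} (hφ : Continuous φ) {c : X → ℝ} (hc : ContinuousOn c B) {y : Y}
    (h : ∀ x ∈ B, φ x = y → c x < 0) : ∀ᶠ y' in 𝓝 y, ∀ x ∈ B, φ x = y' → c x < 0 := by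
  have hbad : IsCompact (B ∩ c ⁻¹' Ici 0) :=
    hB.of_isClosed_subset (hc.preimage_isClosed_of_isClosed hBc isClosed_Ici) inter_subset_left
  have hy : y ∉ φ '' (B ∩ c ⁻¹' Ici 0) := by
    rintro ⟨x, ⟨hxB, hx⟩, rfl⟩
    exact (h x hxB rfl).not_ge hx
  filter_upwards [(hbad.image hφ).isClosed.isOpen_compl.mem_nhds hy] with y' hy' x hxB hxy
  exact not_le.1 fun hx => hy' ⟨x, ⟨hxB, hx⟩, hxy⟩

/-! ### Admissible controls and the closed loop -/

theorem StateSpace.apply_mem_closedBall {N : ℕ} {n : Fin N → ℕ} {ρ : ℝ} {x : StateSpace n}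
    (hx : x ∈ Metric.closedBall 0 ρ) (i : Fin N) : x i ∈ Metric.closedBall 0 ρ := by
  rw [mem_closedBall_zero_iff] at hx ⊢
  exact (PiLp.norm_apply_le x i).trans hx

theorem uniqueDiffOn_closedBall_zero {E : Type*} [NormedAddCommGroup E] [NormedSpace ℝ E] {ρ : ℝ}
    (hρ : 0 < ρ) : UniqueDiffOn ℝ (Metric.closedBall (0 : E) ρ) :=
  uniqueDiffOn_convex (convex_closedBall 0 ρ)
    ⟨0, mem_interior_iff_mem_nhds.2 (Metric.closedBall_mem_nhds 0 hρ)⟩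

namespace CompositeSystem

variable {N : ℕ} {n m l : Fin N → ℕ} {S : CompositeSystem n m l} {ρ : ℝ}
  {V : ∀ i, Euc (n i) → ℝ} {Λ : Euc N → Euc N}

theorem convex_admissible (S : CompositeSystem n m l) (V : ∀ i, Euc (n i) → ℝ)
    (Λ : Euc N → Euc N) (ρ : ℝ) (i : Fin N) (y : Euc (l i)) :
    Convex ℝ {u | S.Admissible V Λ ρ i y u} := by
  intro u hu v hv a b ha hb hab x hx
  have h1 := hu x hx
  have h2 := hv x hx
  unfold dirDeriv at h1 h2 ⊢
  set p := fderivWithin ℝ (V i) (Metric.closedBall 0 ρ) (x i) (S.f i x)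
  set q := Λ (vectorV V x) i
  rw [map_add, map_add, map_smul, map_smul, map_smul, map_smul, smul_eq_mul, smul_eq_mul]
  set r := fderivWithin ℝ (V i) (Metric.closedBall 0 ρ) (x i) (S.g i x u)
  set s := fderivWithin ℝ (V i) (Metric.closedBall 0 ρ) (x i) (S.g i x v)
  have h3 := convex_Iio (q - p) (show r ∈ Iio (q - p) from by rw [mem_Iio]; linarith)
    (show s ∈ Iio (q - p) from by rw [mem_Iio]; linarith) ha hb hab
  rw [mem_Iio, smul_eq_mul, smul_eq_mul] at h3
  linarith

namespace IsOCVLF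

theorem vectorV_mem_orthant (hV : S.IsOCVLF V Λ ρ) {x : StateSpace n}
    (hx : x ∈ Metric.closedBall 0 ρ) : vectorV V x ∈ orthant N := fun i => by
  change 0 ≤ V i (x i)
  rcases eq_or_ne (x i) 0 with h | h
  · rw [h, hV.V_zero]
  · exact (hV.V_pos i _ (StateSpace.apply_mem_closedBall hx i) h).le

theorem continuousOn_vectorV (hV : S.IsOCVLF V Λ ρ) :
    ContinuousOn (vectorV V) (Metric.closedBall (0 : StateSpace n) ρ) :=
  (PiLp.continuous_toLp 2 _).comp_continuousOn <| continuousOn_pi.2 fun i =>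
    (hV.V_contDiff i).continuousOn.comp (PiLp.continuous_apply 2 _ i).continuousOn
      fun _ hx => StateSpace.apply_mem_closedBall hx i

theorem continuousOn_dirDeriv (hV : S.IsOCVLF V Λ ρ) (hρ : 0 < ρ) (i : Fin N)
    {w : StateSpace n → Euc (n i)} (hw : Continuous w) :
    ContinuousOn (fun x => dirDeriv V ρ i x (w x)) (Metric.closedBall 0 ρ) :=
  (((hV.V_contDiff i).continuousOn_fderivWithin (uniqueDiffOn_closedBall_zero hρ) le_rfl).comp
    (PiLp.continuous_apply 2 _ i).continuousOn
    fun _ hx => StateSpace.apply_mem_closedBall hx i).clm_apply hw.continuousOn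

theorem eventually_admissible (hV : S.IsOCVLF V Λ ρ) (hρ : 0 < ρ) {i : Fin N} {y : Euc (l i)}
    {u : Euc (m i)} (hu : S.Admissible V Λ ρ i y u) :
    ∀ᶠ y' in 𝓝 y, S.Admissible V Λ ρ i y' u := by
  have hc : ContinuousOn (fun x => dirDeriv V ρ i x (S.f i x) + dirDeriv V ρ i x (S.g i x u) -
      Λ (vectorV V x) i) (Metric.closedBall 0 ρ) := by
    refine ((hV.continuousOn_dirDeriv hρ i (S.f_smooth i).continuous).add
      (hV.continuousOn_dirDeriv hρ i ((S.g_smooth i).continuous.clm_apply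
        continuous_const))).sub ?_
    exact (PiLp.continuous_apply 2 _ i).comp_continuousOn
      (hV.Λ_lipschitz.continuousOn.comp hV.continuousOn_vectorV
        fun _ hx => hV.vectorV_mem_orthant hx)
  have h := (isCompact_closedBall (0 : StateSpace n) ρ).eventually_forall_fiber_neg
    Metric.isClosed_closedBall
    (φ := fun x => S.h i (x i)) ((S.h_smooth i).continuous.comp (PiLp.continuous_apply 2 _ i)) hc
    (y := y) (fun x hx hxy => sub_neg.2 (hu x ⟨hx, hxy⟩))
  filter_upwards [h] with y' hy' x hx
  exact sub_neg.1 (hy' x hx.1 hx.2)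

/-- The small control property yields continuous feedback functions with admissible values. -/
theorem exists_feedback (hV : S.IsOCVLF V Λ ρ) (hρ : 0 < ρ)
    (hscp : S.SmallControlProperty V Λ ρ) (i : Fin N) :
    ∃ Γ : Euc (l i) → Euc (m i), Continuous Γ ∧ Γ 0 = 0 ∧
      ∀ y ≠ 0, S.Admissible V Λ ρ i y (Γ y) := by
  obtain ⟨μ, hμ, hμ0, hμpos, hu⟩ := hscp i
  refine exists_continuous_selection_of_norm_lt hμ hμ0
    (fun y => S.convex_admissible V Λ ρ i y) fun y hy => ?_
  by_cases hK : y ∈ S.K i (Metric.closedBall 0 ρ)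
  · obtain ⟨u, hlt, hadm⟩ := hu y ⟨hK, hy⟩
    exact ⟨u, hlt, hV.eventually_admissible hρ hadm⟩
  · -- the fibre over `y` is empty, so that every control is admissible
    exact ⟨0, by simpa using hμpos y hy,
      hV.eventually_admissible hρ fun x hx => absurd ⟨x, hx⟩ hK⟩

theorem isVectorLyapunov_closedLoop (hV : S.IsOCVLF V Λ ρ)
    {Γ : ∀ i, Euc (l i) → Euc (m i)} (hΓ0 : ∀ i, Γ i 0 = 0)
    (hΓ : ∀ i, ∀ y ≠ 0, S.Admissible V Λ ρ i y (Γ i y)) :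
    IsVectorLyapunov (S.closedLoop Γ) (vectorV V) Λ ρ where
  continuousOn := hV.continuousOn_vectorV
  mem_orthant _ hx := hV.vectorV_mem_orthant hx
  zero := by
    ext i
    exact hV.V_zero i
  eq_zero x hx h := by
    ext1 i
    by_contra hne
    have hi : V i (x i) = 0 := congrArg (fun z : Euc N => z i) h
    exact (hV.V_pos i _ (StateSpace.apply_mem_closedBall hx i) hne).ne' hi
  deriv_le x hx i := by
    have hV' := ((hV.V_contDiff i).differentiableOn one_ne_zero _
      (StateSpace.apply_mem_closedBall hx i)).hasFDerivWithinAt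
    refine ⟨_, hV'.comp x (PiLp.proj 2 (𝕜 := ℝ) _ i).hasFDerivWithinAt
      fun _ hx => StateSpace.apply_mem_closedBall hx i, ?_⟩
    change fderivWithin ℝ (V i) (Metric.closedBall 0 ρ) (x i)
      (S.f i x + S.g i x (Γ i (S.h i (x i)))) ≤ _
    rw [map_add]
    by_cases hy : S.h i (x i) = 0
    · rw [hy, hΓ0, map_zero, map_zero, add_zero]
      rcases eq_or_ne x 0 with rfl | hx0
      · have hzero : vectorV V (0 : StateSpace n) = 0 := by
          ext j
          exact hV.V_zero j
        rw [S.f_zero, map_zero, hzero, hV.Λ_zero]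
        rfl
      · exact (hV.drift i x ⟨⟨hx, hy⟩, hx0⟩).le
    · exact (hΓ i _ hy x ⟨hx, rfl⟩).le

end IsOCVLF

theorem continuous_closedLoop (S : CompositeSystem n m l) {Γ : ∀ i, Euc (l i) → Euc (m i)}
    (hΓ : ∀ i, Continuous (Γ i)) : Continuous (S.closedLoop Γ) :=
  (PiLp.continuous_toLp 2 _).comp <| continuous_pi fun i =>
    (S.f_smooth i).continuous.add <| (S.g_smooth i).continuous.clm_apply <|
      (hΓ i).comp <| (S.h_smooth i).continuous.comp <| PiLp.continuous_apply 2 _ i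

theorem closedLoop_zero (S : CompositeSystem n m l) {Γ : ∀ i, Euc (l i) → Euc (m i)}
    (hΓ : ∀ i, Γ i 0 = 0) : S.closedLoop Γ 0 = 0 := by
  ext1 i
  change S.f i 0 + S.g i 0 (Γ i (S.h i 0)) = 0
  rw [S.f_zero, S.h_zero, hΓ, map_zero, add_zero]

end CompositeSystem

theorem theorem2 {N : ℕ} {n m l : Fin N → ℕ} (S : CompositeSystem n m l) (ρ : ℝ) (hρ : 0 < ρ)
    (V : ∀ i, Euc (n i) → ℝ) (Λ : Euc N → Euc N)
    (hV : S.IsOCVLF V Λ ρ) (hscp : S.SmallControlProperty V Λ ρ) :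
    ∃ Γ : ∀ i, Euc (l i) → Euc (m i),
      (∀ i, Continuous (Γ i)) ∧ (∀ i, Γ i 0 = 0) ∧
        IsAsymptoticallyStable (S.closedLoop Γ) Set.univ := by
  choose Γ hΓc hΓ0 hΓ using hV.exists_feedback hρ hscp
  exact ⟨Γ, hΓc, hΓ0, (hV.isVectorLyapunov_closedLoop hΓ0 hΓ).isAsymptoticallyStable hρ
    (S.continuous_closedLoop hΓc) (S.closedLoop_zero hΓ0) hV.Λ_lipschitz hV.Λ_quasimonotone
    hV.comparison⟩
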